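/- Let $X$ be a locally finite connected graph with vertex set endowed with the graph metric $d$. Assume that $X$ is Helly, that is, every family of pairwise intersecting combinatorial balls of $X$ has a non-empty global intersection. Assume also that $X$ has finite combinatorial dimension. Here the combinatorial dimension of $X$ is the dimension of its injective hull $EX$, the set of pointwise minimal functions among all $f: X\to\mathbb R$ with $f(x)+f(y)\ge d(x,y)$ for all $x,y\in X$; $EX$ is a polyhedral complex whose smallest closed cell containing $f$ is $\{g\in EX : g(x)+g(y)=d(x,y)\text{ whenever } f(x)+f(y)=d(x,y)\}$, and its dimension is the supremum of the affine dimensions of its cells. An automorphism $g$ of $X$ is called hyperbolic if for some vertex $x$ the map $\mathbb Z\to X$, $n\mapsto g^n\cdot x$, is a quasi-isometric embedding, that is, there are $a\ge 1$ and $b\ge 0$ such that $\frac1a|m-n|-b\le d(g^m\cdot x,g^n\cdot x)\le a|m-n|+b$ for all $m,n\in\mathbb Z$. A group of automorphisms of $X$ is called elliptic if it stabilizes a non-empty clique of $X$ (as a set). 1. Let $G$ be a finitely generated group acting on $X$ by automorphisms (not necessarily faithfully). Then either $G$ stabilizes a non-empty clique of $X$, or some element of $G$ acts as a hyperbolic automorphism,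 and these two cases exclude each other. Moreover, every element of $G$ that acts as a hyperbolic automorphism has infinite order in $G$. 2. Let $G,H$ be elliptic groups of automorphisms of $X$ (not necessarily finitely generated). Then either the group $\langle G,H\rangle$ that they generate is elliptic, or $\langle G,H\rangle$ contains a hyperbolic automorphism, and these two cases exclude each other. -/

import Mathlib

namespace HellyGraph

universe u

variable {V : Type u}

/-- A graph is locally finite if every vertex has only finitely many neighbours. -/
def IsLocallyFinite (X : SimpleGraph V) : Prop :=
  ∀ v : V, (X.neighborSet v).Finite

/-- The combinatorial ball with centre `c` and radius `r` in the graph metric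
(meaningful for connected graphs, the only ones it is used for). -/
def ball (X : SimpleGraph V) (c : V) (r : ℕ) : Set V :=
  {v | X.dist c v ≤ r}

/-- A connected graph is Helly if every family (of any cardinality) of pairwise intersecting
combinatorial balls has a non-empty global intersection. A ball is encoded by its
centre and radius. -/
def IsHelly (X : SimpleGraph V) : Prop :=
  X.Connected ∧
    ∀ B : Set (V × ℕ),
      (∀ b ∈ B, ∀ b' ∈ B, (ball X b.1 b.2 ∩ ball X b'.1 b'.2).Nonempty) →
        (⋂ b ∈ B, ball X b.1 b.2).Nonempty

/-- The injective hull `EX` of (the vertex set of) `X` with the graph metric `d`, realised as the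
set of extremal functions: the pointwise minimal functions among those `f : V → ℝ` with
`d x y ≤ f x + f y` for all `x y`. -/
def injectiveHull (X : SimpleGraph V) : Set (V → ℝ) :=
  {f | Minimal (fun f : V → ℝ => ∀ x y : V, (X.dist x y : ℝ) ≤ f x + f y) f}

/-- The cell of `f` in the polyhedral decomposition of the injective hull: all `g` in the hull such
that every pair `x`, `y` with `f x + f y = d x y` satisfies `g x + g y = d x y`. For `f` in the hull
of a locally finite Helly graph this is the smallest closed cell that contains `f`. -/
def cell (X : SimpleGraph V) (f : V → ℝ) : Set (V → ℝ) :=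
  {g | g ∈ injectiveHull X ∧
    ∀ x y : V, f x + f y = (X.dist x y : ℝ) → g x + g y = (X.dist x y : ℝ)}

/-- The combinatorial dimension of `X`: the dimension of its injective hull as a polyhedral complex,
that is, the supremum in `{0, 1, 2, …, ∞}` of the affine dimensions of its cells. -/
noncomputable def combinatorialDimension (X : SimpleGraph V) : ℕ∞ :=
  ⨆ f : injectiveHull X, Cardinal.toENat (Module.rank ℝ (vectorSpan ℝ (cell X (f : V → ℝ))))

/-- A group of automorphisms is elliptic if it stabilizes a (non-empty) clique. -/
def IsElliptic {X : SimpleGraph V} (K : Subgroup (X ≃g X)) : Prop :=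
  ∃ C : Set V, C.Nonempty ∧ X.IsClique C ∧ ∀ g ∈ K, g '' C = C

/-- An automorphism `g` is hyperbolic if for some vertex `x` the orbit map `n ↦ gⁿ x` is a
quasi-isometric embedding of `ℤ`. -/
def IsHyperbolic {X : SimpleGraph V} (g : X ≃g X) : Prop :=
  ∃ (x : V) (a b : ℝ), 1 ≤ a ∧ 0 ≤ b ∧ ∀ m n : ℤ,
    a⁻¹ * |(m : ℝ) - n| - b ≤ (X.dist ((g ^ m) x) ((g ^ n) x) : ℝ) ∧
      (X.dist ((g ^ m) x) ((g ^ n) x) : ℝ) ≤ a * |(m : ℝ) - n| + b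

end HellyGraph

/-! Elliptic and hyperbolic exclude each other because powers of a clique-preserving automorphism
move a vertex of the clique by at most 1. For the alternative, let `S` be a symmetric generating set
containing 1 and moving a base vertex `x` a bounded amount; `S` may be infinite. Let `l` be the
infimum of the `r` such that some `f` with `d u v ≤ f u + f v` satisfies `f (s u) ≤ f u + r` for all
`s ∈ S`.

Finite combinatorial dimension makes `l` attained and rational. Near-optimal functions can be taken
in the injective hull, where the dimension of a cell bounds the number of fractional parts of the
values. A limit of these fractional parts attains `l`, and an irrational `l` could be lowered by a
`ℚ`-linear perturbation.

If `l = 0`, the function `f` does not increase along the group, so orbits are bounded, and shrinking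
intersections of balls produce an invariant clique. If `l > 0`, then `l` is the asymptotic speed of
words: some word of each length `n` moves `x` by more than `n * l - 1`. Its prefixes have finitely
many types, by local finiteness and rationality. Two prefixes of equal type bound a subword `γ`, and
the Helly property turns local distance comparison into global comparison (`IsHelly.busemann_le`),
so the powers of `γ` move `x` at linear speed. -/

namespace HellyGraph

/-! ### Helly geometry, invariant cliques and hyperbolicity. -/

section Graph

variable {V : Type*} {X : SimpleGraph V}

theorem dist_apply_apply (g : X ≃g X) (u v : V) : X.dist (g u) (g v) = X.dist u v := by
  have key : ∀ (g : X ≃g X) (u v : V), X.edist (g u) (g v) ≤ X.edist u v := by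
    intro g u v
    by_cases h : X.Reachable u v
    · obtain ⟨w, hw⟩ := h.exists_walk_length_eq_edist
      rw [← hw]
      simpa using SimpleGraph.edist_le (w.map g.toHom)
    · rw [SimpleGraph.edist_eq_top_of_not_reachable h]
      exact le_top
  have h1 := key g u v
  have h2 := key g.symm (g u) (g v)
  simp only [RelIso.symm_apply_apply] at h2
  unfold SimpleGraph.dist
  rw [le_antisymm h1 h2]

theorem dist_inv_apply (g : X ≃g X) (u v : V) : X.dist (g⁻¹ u) v = X.dist u (g v) := by
  rw [← dist_apply_apply g (g⁻¹ u) v, RelIso.apply_inv_self]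

theorem dist_triangle_real (hX : X.Connected) (u v w : V) :
    (X.dist u w : ℝ) ≤ X.dist u v + X.dist v w := by
  exact_mod_cast hX.dist_triangle (u := u) (v := v) (w := w)

/-- Two balls whose radii add up to at least the distance of the centres intersect. -/
theorem exists_dist_le_of_dist_le_add (hX : X.Connected) {u v : V} {r s : ℕ}
    (h : X.dist u v ≤ r + s) : ∃ q, X.dist u q ≤ r ∧ X.dist v q ≤ s := by
  obtain ⟨w, hw⟩ := hX.exists_walk_length_eq_dist u v
  refine ⟨w.getVert r, ?_, ?_⟩
  · exact (SimpleGraph.dist_le (w.take r)).trans (by simp)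
  · rw [SimpleGraph.dist_comm]
    refine (SimpleGraph.dist_le (w.drop r)).trans ?_
    simp
    omega

theorem IsHelly.exists_forall_dist_le (hX : IsHelly X) (B : Set (V × ℕ))
    (hB : ∀ b ∈ B, ∀ b' ∈ B, X.dist b.1 b'.1 ≤ b.2 + b'.2) :
    ∃ q, ∀ b ∈ B, X.dist b.1 q ≤ b.2 := by
  obtain ⟨q, hq⟩ := hX.2 B fun b hb b' hb' ↦
    exists_dist_le_of_dist_le_add hX.1 (hB b hb b' hb')
  exact ⟨q, fun b hb ↦ by simpa [ball] using Set.mem_iInter₂.1 hq b hb⟩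

theorem IsHelly.exists_dist_le_three (hX : IsHelly X) {c₁ c₂ c₃ : V} {r₁ r₂ r₃ : ℕ}
    (h₁₂ : X.dist c₁ c₂ ≤ r₁ + r₂) (h₁₃ : X.dist c₁ c₃ ≤ r₁ + r₃)
    (h₂₃ : X.dist c₂ c₃ ≤ r₂ + r₃) :
    ∃ q, X.dist c₁ q ≤ r₁ ∧ X.dist c₂ q ≤ r₂ ∧ X.dist c₃ q ≤ r₃ := by
  have h₂₁ := h₁₂
  have h₃₁ := h₁₃
  have h₃₂ := h₂₃
  rw [SimpleGraph.dist_comm] at h₂₁ h₃₁ h₃₂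
  obtain ⟨q, hq⟩ := hX.exists_forall_dist_le {(c₁, r₁), (c₂, r₂), (c₃, r₃)} (by
    rintro b (rfl | rfl | rfl) b' (rfl | rfl | rfl) <;> simp <;> omega)
  exact ⟨q, hq (c₁, r₁) (by simp), hq (c₂, r₂) (by simp), hq (c₃, r₃) (by simp)⟩

/-- The distance to a far point `z` seen from `O` past `p` is controlled by the distance
function of `O` on a ball around `p`. -/
theorem IsHelly.busemann_le (hX : IsHelly X) {O O' p z : V} {E R : ℕ} (hR : E + 1 ≤ R)
    (hz : X.dist O p + X.dist p z ≤ X.dist O z + E)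
    (hT : ∀ q, X.dist p q ≤ R → X.dist O q + X.dist O' p ≤ X.dist O' q + X.dist O p) :
    X.dist O z + X.dist O' p ≤ X.dist O' z + X.dist O p := by
  by_contra! hlt
  have t := hX.1.dist_triangle (u := O') (v := p) (w := z)
  -- If the inequality fails, these three balls meet pairwise. A common point `q` would, by `hT`,
  -- give a path from `O` to `z` through `q` shorter than `X.dist O z`. When `z` is within `R` of
  -- `p`, the second radius truncates to 0; `E + 1 ≤ R` covers that case.
  obtain ⟨q, h₁, h₂, h₃⟩ := hX.exists_dist_le_three (c₁ := O') (c₂ := z) (c₃ := p)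
    (r₁ := X.dist O z + X.dist O' p - X.dist O p - 1 - (X.dist p z - R))
    (r₂ := X.dist p z - R) (r₃ := R) (by omega) (by omega)
    (by rw [SimpleGraph.dist_comm]; omega)
  have h₄ := hT q h₃
  have h₅ := hX.1.dist_triangle (u := O) (v := q) (w := z)
  rw [SimpleGraph.dist_comm] at h₂
  omega

theorem IsLocallyFinite.finite_setOf_dist_le (hX : X.Connected) (hfin : IsLocallyFinite X)
    (x : V) (R : ℕ) : {q | X.dist x q ≤ R}.Finite := by
  induction R with
  | zero => exact (Set.finite_singleton x).subset fun q hq ↦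
      ((hX.dist_eq_zero_iff).1 (Nat.le_zero.1 hq)).symm
  | succ R ih =>
    refine (ih.union (ih.biUnion fun v _ ↦ hfin v)).subset fun q hq ↦ ?_
    obtain ⟨y, h₁, h₂⟩ := exists_dist_le_of_dist_le_add hX (r := R) (s := 1) hq
    by_cases hy : y = q
    · exact Or.inl (hy ▸ h₁)
    · refine Or.inr (Set.mem_biUnion h₁ ?_)
      have := hX.pos_dist_of_ne hy
      rw [SimpleGraph.dist_comm] at h₂
      exact SimpleGraph.dist_eq_one_iff_adj.1 (by omega)

/-- Adding the balls of radius `⌈D / 2⌉` about all points of the intersection keeps the family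
invariant and pairwise intersecting. Points of the new intersection lie in the old one and are
centres of added balls, so the diameter drops to `⌈D / 2⌉`. At diameter at most 1 the intersection
is a clique. -/
theorem IsHelly.exists_invariant_clique_of_diam (hX : IsHelly X) (Γ : Subgroup (X ≃g X)) (D : ℕ) :
    ∀ B : Set (V × ℕ), {q | ∀ b ∈ B, X.dist b.1 q ≤ b.2}.Nonempty →
      (∀ q q', (∀ b ∈ B, X.dist b.1 q ≤ b.2) → (∀ b ∈ B, X.dist b.1 q' ≤ b.2) →
        X.dist q q' ≤ D) →
      (∀ γ ∈ Γ, ∀ b ∈ B, (γ b.1, b.2) ∈ B) →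
      ∃ C : Set V, C.Nonempty ∧ X.IsClique C ∧ ∀ γ ∈ Γ, ∀ q ∈ C, γ q ∈ C := by
  induction D using Nat.strong_induction_on with
  | _ D ih =>
  intro B hne hdiam hinv
  have hmem : ∀ γ ∈ Γ, ∀ q, (∀ b ∈ B, X.dist b.1 q ≤ b.2) → ∀ b ∈ B, X.dist b.1 (γ q) ≤ b.2 := by
    intro γ hγ q hq b hb
    have := hq _ (hinv γ⁻¹ (Γ.inv_mem hγ) b hb)
    rwa [dist_inv_apply] at this
  by_cases hD : D ≤ 1
  · refine ⟨_, hne, fun q hq q' hq' hqq' ↦ ?_, fun γ hγ q hq ↦ hmem γ hγ q hq⟩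
    have := hX.1.pos_dist_of_ne hqq'
    have := hdiam q q' hq hq'
    exact SimpleGraph.dist_eq_one_iff_adj.1 (by omega)
  · set k := (D + 1) / 2 with hk
    obtain ⟨q, hq⟩ := hX.exists_forall_dist_le
      (B ∪ {b | (∀ a ∈ B, X.dist a.1 b.1 ≤ a.2) ∧ b.2 = k}) (by
        obtain ⟨q₀, hq₀⟩ := hne
        rintro b (hb | ⟨hb, hbk⟩) b' (hb' | ⟨hb', hbk'⟩)
        · have h₁ := hq₀ b hb
          have h₂ := hq₀ b' hb'
          have h₃ := hX.1.dist_triangle (u := b.1) (v := q₀) (w := b'.1)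
          rw [SimpleGraph.dist_comm] at h₂
          omega
        · have := hb' b hb
          omega
        · have := hb b' hb'
          rw [SimpleGraph.dist_comm]
          omega
        · have := hdiam _ _ hb hb'
          omega)
    refine ih k (by omega) _ ⟨q, hq⟩ ?_ ?_
    · intro q q' hq hq'
      exact hq' (q, k) (Or.inr ⟨fun b hb ↦ hq b (Or.inl hb), rfl⟩)
    · rintro γ hγ b (hb | ⟨hb, hbk⟩)
      · exact Or.inl (hinv γ hγ b hb)
      · exact Or.inr ⟨hmem γ hγ _ hb, hbk⟩

/-- A group of automorphisms of a Helly graph with a bounded orbit stabilizes a clique. -/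
theorem IsHelly.isElliptic_of_bounded (hX : IsHelly X) (Γ : Subgroup (X ≃g X)) (x : V) (M : ℕ)
    (hM : ∀ γ ∈ Γ, X.dist x (γ x) ≤ M) : IsElliptic Γ := by
  have h₁ : ∀ b ∈ {b : V × ℕ | ∃ γ ∈ Γ, b = (γ x, M)}, X.dist b.1 x ≤ b.2 := by
    rintro _ ⟨γ, hγ, rfl⟩
    rw [SimpleGraph.dist_comm]
    exact hM γ hγ
  have h₂ : ∀ γ ∈ Γ, ∀ b ∈ {b : V × ℕ | ∃ γ ∈ Γ, b = (γ x, M)},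
      (γ b.1, b.2) ∈ {b : V × ℕ | ∃ γ ∈ Γ, b = (γ x, M)} := by
    rintro g hg _ ⟨γ, hγ, rfl⟩
    exact ⟨g * γ, Γ.mul_mem hg hγ, rfl⟩
  obtain ⟨C, hne, hC, hinv⟩ := hX.exists_invariant_clique_of_diam Γ (2 * M) _ ⟨x, h₁⟩
    (fun q q' hq hq' ↦ by
      have h₁ := hq (x, M) ⟨1, Γ.one_mem, rfl⟩
      have h₂ := hq' (x, M) ⟨1, Γ.one_mem, rfl⟩
      have h₃ := hX.1.dist_triangle (u := q) (v := x) (w := q')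
      rw [SimpleGraph.dist_comm] at h₁
      simp only at h₁ h₂
      omega) h₂
  refine ⟨C, hne, hC, fun g hg ↦ Set.Subset.antisymm ?_ ?_⟩
  · rintro _ ⟨q, hq, rfl⟩
    exact hinv g hg q hq
  · intro q hq
    exact ⟨g⁻¹ q, hinv _ (Γ.inv_mem hg) q hq, RelIso.apply_inv_self g q⟩

theorem dist_pow_apply_natAbs (g : X ≃g X) (x : V) (m n : ℤ) :
    X.dist ((g ^ m) x) ((g ^ n) x) = X.dist x ((g ^ (m - n).natAbs) x) := by
  have key : ∀ m n : ℤ, X.dist ((g ^ m) x) ((g ^ n) x) = X.dist x ((g ^ (n - m)) x) := by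
    intro m n
    rw [← dist_apply_apply (g ^ m) x, ← RelIso.mul_apply, ← zpow_add]
    congr 3
    ring
  rcases le_total m n with h | h
  · rw [key, ← zpow_natCast, Int.natCast_natAbs, abs_of_nonpos (by omega), neg_sub]
  · rw [SimpleGraph.dist_comm, key, ← zpow_natCast, Int.natCast_natAbs, abs_of_nonneg (by omega)]

theorem dist_pow_apply_le (hX : X.Connected) (g : X ≃g X) (x : V) (n : ℕ) :
    X.dist x ((g ^ n) x) ≤ n * X.dist x (g x) := by
  induction n with
  | zero => simp
  | succ n ih =>
    have h := hX.dist_triangle (u := x) (v := (g ^ n) x) (w := (g ^ (n + 1)) x)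
    rw [pow_succ, RelIso.mul_apply, dist_apply_apply] at h
    rw [pow_succ, RelIso.mul_apply, add_mul, one_mul]
    omega

theorem isHyperbolic_of_forall_le_dist (hX : X.Connected) (g : X ≃g X) (x : V) {c : ℝ} (hc : 0 < c)
    (h : ∀ n : ℕ, n * c ≤ X.dist x ((g ^ n) x)) : IsHyperbolic g := by
  refine ⟨x, max (max 1 c⁻¹) (X.dist x (g x)), 0, by simp, le_rfl, fun m n ↦ ?_⟩
  have habs : |(m : ℝ) - n| = ((m - n).natAbs : ℕ) := by
    rw [Nat.cast_natAbs]
    push_cast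
    rfl
  rw [dist_pow_apply_natAbs, habs, sub_zero, add_zero]
  set k := (m - n).natAbs
  constructor
  · refine le_trans ?_ (h k)
    rw [mul_comm]
    gcongr
    exact inv_le_of_inv_le₀ hc ((le_max_right _ _).trans (le_max_left _ _))
  · have h₁ : (X.dist x ((g ^ k) x) : ℝ) ≤ k * X.dist x (g x) := by
      exact_mod_cast dist_pow_apply_le hX g x k
    refine h₁.trans ?_
    rw [mul_comm]
    gcongr
    exact le_max_right _ _

/-- The multiples of `N` serve the torsion case, where `g ^ N = 1`. -/
theorem IsHyperbolic.not_bounded {g : X ≃g X} (hX : X.Connected) (hg : IsHyperbolic g) (y : V)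
    (M : ℝ) (N : ℕ) (hN : 0 < N) : ∃ n : ℕ, M < X.dist y ((g ^ (N * n)) y) := by
  obtain ⟨x, a, b, ha, hb, h⟩ := hg
  by_contra! hM
  obtain ⟨n, hn⟩ := exists_nat_gt (a * (M + b + 2 * X.dist x y))
  have h₁ := (h (N * n : ℕ) 0).1
  rw [dist_pow_apply_natAbs, sub_zero, Int.natAbs_natCast] at h₁
  have h₂ := dist_triangle_real hX x y ((g ^ (N * n)) x)
  have h₃ := dist_triangle_real hX y ((g ^ (N * n)) y) ((g ^ (N * n)) x)
  rw [dist_apply_apply, SimpleGraph.dist_comm (u := y) (v := x)] at h₃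
  have h₄ := hM n
  have h₅ : a⁻¹ * n ≤ a⁻¹ * |(((N * n : ℕ) : ℤ) : ℝ) - ((0 : ℤ) : ℝ)| := by
    have : (n : ℝ) ≤ ((N * n : ℕ) : ℝ) := by exact_mod_cast Nat.le_mul_of_pos_left n hN
    gcongr
    simpa using this
  have h₆ : (M + b + 2 * X.dist x y) < a⁻¹ * n := by
    rw [inv_mul_eq_div, lt_div_iff₀ (by linarith)]
    linarith
  linarith

theorem not_isHyperbolic_of_image_clique (hX : X.Connected) {C : Set V} (hne : C.Nonempty)
    (hC : X.IsClique C) {g : X ≃g X} (hg : g '' C = C) : ¬ IsHyperbolic g := by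
  intro h
  obtain ⟨y, hy⟩ := hne
  obtain ⟨n, hn⟩ := h.not_bounded hX y 1 1 one_pos
  have hmem : ∀ n : ℕ, (g ^ n) y ∈ C := by
    intro n
    induction n with
    | zero => simpa
    | succ n ih =>
      rw [pow_succ', RelIso.mul_apply, ← hg]
      exact Set.mem_image_of_mem g ih
  by_cases heq : y = (g ^ (1 * n)) y
  · rw [← heq] at hn
    norm_num at hn
  · rw [SimpleGraph.dist_eq_one_iff_adj.2 (hC hy (hmem _) heq)] at hn
    norm_num at hn

end Graph

/-! ### Extremal functions and the fractional parts of their values. -/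

section Hull

variable {V : Type*} {X : SimpleGraph V}

/-- The functions among which the injective hull consists of the minimal ones. -/
def IsAdmissible (X : SimpleGraph V) (f : V → ℝ) : Prop :=
  ∀ x y : V, (X.dist x y : ℝ) ≤ f x + f y

/-- Every element of `S` displaces `f` by at most `r` in the supremum norm (for symmetric `S`). -/
def DisplacedAtMost (S : Set (X ≃g X)) (r : ℝ) (f : V → ℝ) : Prop :=
  ∀ s ∈ S, ∀ u : V, f (s u) ≤ f u + r

theorem IsAdmissible.nonneg {f : V → ℝ} (hf : IsAdmissible X f) (u : V) : 0 ≤ f u := by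
  have := hf u u
  simp only [SimpleGraph.dist_self, Nat.cast_zero] at this
  linarith

/-- Zorn's lemma: the infimum of a chain stays admissible, since the smaller of two members serves
both points. -/
theorem IsAdmissible.exists_minimal {S : Set (X ≃g X)} {r : ℝ} {f : V → ℝ}
    (hf : IsAdmissible X f) (hr : DisplacedAtMost S r f) :
    ∃ g, Minimal (fun g ↦ IsAdmissible X g ∧ DisplacedAtMost S r g) g := by
  obtain ⟨m, -, hm⟩ := zorn_le_nonempty₀ (α := (V → ℝ)ᵒᵈ)
    {g | IsAdmissible X (OrderDual.ofDual g) ∧ DisplacedAtMost S r (OrderDual.ofDual g)}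
    (fun c hc hchain y hy ↦ by
      have : Nonempty c := ⟨⟨y, hy⟩⟩
      have hbdd : ∀ u, BddBelow (Set.range fun h : c ↦ OrderDual.ofDual h.1 u) := by
        rintro u
        refine ⟨0, ?_⟩
        rintro _ ⟨h, rfl⟩
        exact (hc h.2).1.nonneg u
      refine ⟨OrderDual.toDual fun u ↦ ⨅ h : c, OrderDual.ofDual h.1 u, ⟨?_, ?_⟩, ?_⟩
      · intro u v
        have key : ∀ h h' : c, (X.dist u v : ℝ) ≤
            OrderDual.ofDual h.1 u + OrderDual.ofDual h'.1 v := by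
          intro h h'
          rcases hchain.total h.2 h'.2 with hle | hle
          · have h₁ : OrderDual.ofDual h'.1 u ≤ OrderDual.ofDual h.1 u := hle u
            linarith [(hc h'.2).1 u v]
          · have h₁ : OrderDual.ofDual h.1 v ≤ OrderDual.ofDual h'.1 v := hle v
            linarith [(hc h.2).1 u v]
        have h₁ : ∀ h : c, (X.dist u v : ℝ) - OrderDual.ofDual h.1 u ≤
            ⨅ h : c, OrderDual.ofDual h.1 v := fun h ↦ le_ciInf fun h' ↦ by linarith [key h h']
        have h₂ : (X.dist u v : ℝ) - ⨅ h : c, OrderDual.ofDual h.1 v ≤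
            ⨅ h : c, OrderDual.ofDual h.1 u := le_ciInf fun h ↦ by linarith [h₁ h]
        simp only [OrderDual.ofDual_toDual]
        linarith
      · intro s hs u
        have h₁ : (⨅ h : c, OrderDual.ofDual h.1 (s u)) - r ≤
            ⨅ h : c, OrderDual.ofDual h.1 u := le_ciInf fun h ↦ by
          have h₂ := ciInf_le (hbdd (s u)) h
          linarith [(hc h.2).2 s hs u]
        simp only [OrderDual.ofDual_toDual]
        linarith
      · intro z hz u
        exact ciInf_le (hbdd u) ⟨z, hz⟩)
    (OrderDual.toDual f) ⟨hf, hr⟩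
  exact ⟨OrderDual.ofDual m, hm.1, fun g hg hle ↦ hm.2 (y := OrderDual.toDual g) hg hle⟩

/-- Any displacement bound realised by an admissible function is realised in the injective hull. -/
theorem IsAdmissible.exists_mem_injectiveHull {S : Set (X ≃g X)} (hS : ∀ s ∈ S, s⁻¹ ∈ S) {r : ℝ}
    {f : V → ℝ} (hf : IsAdmissible X f) (hr : DisplacedAtMost S r f) :
    ∃ g ∈ injectiveHull X, DisplacedAtMost S r g := by
  obtain ⟨g, ⟨hg, hgr⟩, hmin⟩ := hf.exists_minimal hr
  set e : V → ℝ := fun u ↦ ⨆ v, ((X.dist u v : ℝ) - g v) with he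
  have hbdd : ∀ u, BddAbove (Set.range fun v ↦ (X.dist u v : ℝ) - g v) := by
    refine fun u ↦ ⟨g u, ?_⟩
    rintro _ ⟨v, rfl⟩
    linarith [hg u v]
  have hle : ∀ u v, (X.dist u v : ℝ) - g v ≤ e u := fun u v ↦ le_ciSup (hbdd u) v
  have hne : ∀ u : V, Nonempty V := fun u ↦ ⟨u⟩
  have heg : ∀ u, e u ≤ g u := fun u ↦ by
    have := hne u
    exact ciSup_le fun v ↦ by linarith [hg u v]
  -- The average of `g` and its conjugate `e ≤ g` meets both constraints, so minimality forces `g =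
  -- e`, which makes `g` extremal without the displacement constraint.
  have hmid : g ≤ fun u ↦ (g u + e u) / 2 := by
    refine hmin ⟨?_, ?_⟩ fun u ↦ ?_
    · intro u v
      have h₁ := hle u v
      have h₂ := hle v u
      rw [SimpleGraph.dist_comm] at h₂
      simp only
      linarith
    · intro s hs u
      have h₁ : e (s u) ≤ e u + r := by
        have := hne u
        refine ciSup_le fun v ↦ ?_
        have h₂ := hgr s⁻¹ (hS s hs) v
        have h₃ := hle u (s⁻¹ v)
        rw [SimpleGraph.dist_comm, dist_inv_apply, SimpleGraph.dist_comm] at h₃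
        linarith
      have h₄ := hgr s hs u
      simp only
      linarith
    · simp only
      linarith [heg u]
  refine ⟨g, ⟨hg, fun h hh hhg u ↦ ?_⟩, hgr⟩
  have h₁ := hmid u
  simp only at h₁
  have h₂ : e u ≤ h u := by
    have := hne u
    exact ciSup_le fun v ↦ by linarith [hh u v, hhg v]
  linarith

/-- Otherwise the value at `u` could be lowered by `η / 2`. -/
theorem exists_add_lt_of_mem_injectiveHull {f : V → ℝ} (hf : f ∈ injectiveHull X) (u : V) {η : ℝ}
    (hη : 0 < η) : ∃ v, f u + f v < X.dist u v + η := by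
  classical
  by_contra! h
  have h₁ := hf.2 (y := Function.update f u (f u - η / 2)) (fun x y ↦ by
    have hxy := hf.1 x y
    by_cases hx : x = u <;> by_cases hy : y = u
    · subst hx hy
      have := h y
      simp at this ⊢
      linarith
    · subst hx
      have := h y
      simp [hy]
      linarith
    · subst hy
      have := h x
      rw [SimpleGraph.dist_comm] at this
      simp [hx]
      linarith
    · simpa [hx, hy] using hxy) (fun v ↦ by
      by_cases hv : v = u
      · subst hv
        simp
        linarith
      · simp [hv]) u
  simp at h₁
  linarith

/-- Perturbing an extremal function by an odd, periodic and contracting function of its values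
does not leave the cell. -/
theorem add_comp_mem_cell {f : V → ℝ} (hf : f ∈ injectiveHull X) {ψ : ℝ → ℝ}
    (hneg : ∀ a, ψ (-a) = -ψ a) (hper : ∀ (a : ℝ) (n : ℕ), ψ (a + n) = ψ a)
    (hlip : ∀ a b, |ψ a - ψ b| ≤ |a - b|) : (fun u ↦ f u + ψ (f u)) ∈ cell X f := by
  -- By oddness and periodicity the left side is `|ψ (f u) - ψ (d - f v)|` with `d` the distance, so
  -- the slack of the pair bounds it.
  have key : ∀ u v, |ψ (f u) + ψ (f v)| ≤ f u + f v - X.dist u v := by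
    intro u v
    have h₁ := hlip (f u) (-f v + X.dist u v)
    rw [hper, hneg, sub_neg_eq_add] at h₁
    refine h₁.trans_eq ?_
    rw [abs_of_nonneg (by linarith [hf.1 u v])]
    ring
  refine ⟨⟨fun u v ↦ ?_, fun g hg hle u ↦ ?_⟩, fun u v huv ↦ ?_⟩
  · have := neg_le_of_abs_le (key u v)
    simp only
    linarith
  · refine le_of_forall_pos_le_add fun η hη ↦ ?_
    obtain ⟨v, hv⟩ := exists_add_lt_of_mem_injectiveHull hf u (half_pos hη)
    have h₁ := le_of_abs_le (key u v)
    have h₂ := hg u v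
    have h₃ := hle v
    simp only at h₃ ⊢
    linarith
  · have := key u v
    rw [huv, sub_self, abs_nonpos_iff] at this
    simp only
    linarith

/-- These functions are odd and 1-periodic; division by the Lipschitz constant makes them
contracting, as `add_comp_mem_cell` requires. -/
theorem exists_abs_sin_mul_cos_pow_sub_le (k : ℕ) : ∃ C : ℝ, 0 < C ∧ ∀ a b : ℝ,
    |Real.sin (2 * Real.pi * a) * Real.cos (2 * Real.pi * a) ^ k -
      Real.sin (2 * Real.pi * b) * Real.cos (2 * Real.pi * b) ^ k| ≤ C * |a - b| := by
  have hpi := Real.pi_pos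
  have hscale : ∀ a b : ℝ, |2 * Real.pi * a - 2 * Real.pi * b| = 2 * Real.pi * |a - b| := by
    intro a b
    rw [← mul_sub, abs_mul, abs_of_pos (by positivity)]
  induction k with
  | zero =>
    refine ⟨2 * Real.pi, by positivity, fun a b ↦ ?_⟩
    have := Real.abs_sin_sub_sin_le (2 * Real.pi * a) (2 * Real.pi * b)
    rw [hscale] at this
    simpa
  | succ k ih =>
    obtain ⟨C, hC, h⟩ := ih
    refine ⟨C + 2 * Real.pi, by positivity, fun a b ↦ ?_⟩
    have h₁ := h a b
    have h₂ := Real.abs_cos_sub_cos_le (2 * Real.pi * a) (2 * Real.pi * b)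
    rw [hscale] at h₂
    have h₃ := Real.abs_cos_le_one (2 * Real.pi * a)
    have h₄ : |Real.sin (2 * Real.pi * b) * Real.cos (2 * Real.pi * b) ^ k| ≤ 1 := by
      rw [abs_mul, abs_pow]
      exact mul_le_one₀ (Real.abs_sin_le_one _) (by positivity)
        (pow_le_one₀ (abs_nonneg _) (Real.abs_cos_le_one _))
    set p := Real.sin (2 * Real.pi * a) * Real.cos (2 * Real.pi * a) ^ k
    set q := Real.sin (2 * Real.pi * b) * Real.cos (2 * Real.pi * b) ^ k
    have h₅ : Real.sin (2 * Real.pi * a) * Real.cos (2 * Real.pi * a) ^ (k + 1) -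
        Real.sin (2 * Real.pi * b) * Real.cos (2 * Real.pi * b) ^ (k + 1) =
        (p - q) * Real.cos (2 * Real.pi * a) +
          q * (Real.cos (2 * Real.pi * a) - Real.cos (2 * Real.pi * b)) := by
      simp only [p, q]
      ring
    rw [h₅]
    calc _ ≤ |p - q| * |Real.cos (2 * Real.pi * a)| +
          |q| * |Real.cos (2 * Real.pi * a) - Real.cos (2 * Real.pi * b)| := by
          rw [← abs_mul, ← abs_mul]
          exact abs_add_le _ _
      _ ≤ C * |a - b| * 1 + 1 * (2 * Real.pi * |a - b|) := by gcongr
      _ = _ := by ring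

theorem sin_mul_cos_pow_comp_mem_vectorSpan {f : V → ℝ} (hf : f ∈ injectiveHull X) (k : ℕ) :
    (fun u ↦ Real.sin (2 * Real.pi * f u) * Real.cos (2 * Real.pi * f u) ^ k) ∈
      vectorSpan ℝ (cell X f) := by
  obtain ⟨C, hC, hlip⟩ := exists_abs_sin_mul_cos_pow_sub_le k
  have h₁ : (fun u ↦ f u + C⁻¹ * (Real.sin (2 * Real.pi * f u) *
      Real.cos (2 * Real.pi * f u) ^ k)) ∈ cell X f := by
    refine add_comp_mem_cell hf (ψ := fun a ↦ C⁻¹ * (Real.sin (2 * Real.pi * a) *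
      Real.cos (2 * Real.pi * a) ^ k)) (fun a ↦ ?_) (fun a n ↦ ?_) (fun a b ↦ ?_)
    · simp [Real.sin_neg, Real.cos_neg]
    · have : 2 * Real.pi * (a + n) = 2 * Real.pi * a + n * (2 * Real.pi) := by ring
      simp only [this, Real.sin_add_nat_mul_two_pi, Real.cos_add_nat_mul_two_pi]
    · rw [← mul_sub, abs_mul, abs_of_pos (inv_pos.2 hC), inv_mul_le_iff₀ hC]
      exact hlip a b
  have h₂ : f ∈ cell X f := ⟨hf, fun _ _ h ↦ h⟩
  have h₃ := Submodule.smul_mem _ C (vsub_mem_vectorSpan ℝ h₁ h₂)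
  convert h₃ using 1
  ext u
  simp [hC.ne']

/-- Evaluated at the `u i`, the directions `sin * cos ^ k` form a Vandermonde matrix in the cosines
with rows scaled by nonzero sines. -/
theorem card_le_rank_vectorSpan_cell {f : V → ℝ} (hf : f ∈ injectiveHull X) {m : ℕ} (u : Fin m → V)
    (hinj : Function.Injective fun i ↦ Real.cos (2 * Real.pi * f (u i)))
    (hsin : ∀ i, Real.sin (2 * Real.pi * f (u i)) ≠ 0) :
    (m : Cardinal) ≤ Module.rank ℝ (vectorSpan ℝ (cell X f)) := by
  have hli : LinearIndependent ℝ (fun k : Fin m ↦ (⟨_, sin_mul_cos_pow_comp_mem_vectorSpan hf k⟩ :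
      vectorSpan ℝ (cell X f))) := by
    refine LinearIndependent.of_comp (Submodule.subtype _) (Fintype.linearIndependent_iff.2 ?_)
    intro c hc
    have h₁ : (Matrix.vandermonde fun i ↦ Real.cos (2 * Real.pi * f (u i))).mulVec c = 0 := by
      ext i
      have h₂ := congrFun hc (u i)
      simp only [Function.comp_apply, Submodule.subtype_apply, Finset.sum_apply, Pi.smul_apply,
        smul_eq_mul, Pi.zero_apply] at h₂
      have h₃ : Real.sin (2 * Real.pi * f (u i)) *
          ∑ k : Fin m, Real.cos (2 * Real.pi * f (u i)) ^ (k : ℕ) * c k = 0 := by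
        rw [← h₂, Finset.mul_sum]
        exact Finset.sum_congr rfl fun k _ ↦ by ring
      simpa [Matrix.mulVec, dotProduct, Matrix.vandermonde_apply] using
        (mul_eq_zero.1 h₃).resolve_left (hsin i)
    exact congrFun (Matrix.eq_zero_of_mulVec_eq_zero (Matrix.det_vandermonde_ne_zero_iff.2 hinj) h₁)
  simpa using hli.cardinal_lift_le_rank

/-- In finite combinatorial dimension, the number of fractional parts of the values of an extremal
function is uniformly bounded. -/
theorem exists_fract_eq_of_combinatorialDimension_ne_top (hdim : combinatorialDimension X ≠ ⊤) :
    ∃ M : ℕ, ∀ f ∈ injectiveHull X, ∃ t : Fin M → ℝ, (∀ i, t i ∈ Set.Icc (0 : ℝ) 1) ∧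
      ∀ u, ∃ i, Int.fract (f u) = t i := by
  obtain ⟨N, hN⟩ := ENat.ne_top_iff_exists.1 hdim
  -- At most `N` cosines differ from `1` and `-1`, and each cosine comes from at most two fractional
  -- parts, one on each side of `1 / 2`.
  refine ⟨(N + 2) * 2, fun f hf ↦ ?_⟩
  have hrank : Module.rank ℝ (vectorSpan ℝ (cell X f)) ≤ N := by
    rw [← Cardinal.toENat_le_natCast]
    exact (le_iSup (fun f : injectiveHull X ↦
      Cardinal.toENat (Module.rank ℝ (vectorSpan ℝ (cell X (f : V → ℝ))))) ⟨f, hf⟩).trans hN.ge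
  set A : Set ℝ := Set.range fun u ↦ Real.cos (2 * Real.pi * f u) with hA
  have hA₁ : (A \ {1, -1}).encard ≤ N := by
    by_contra! hlt
    obtain ⟨B, hBA, hB⟩ := Set.exists_subset_encard_eq (Order.add_one_le_of_lt hlt)
    have hBfin : B.Finite := Set.finite_of_encard_eq_coe (k := N + 1) (by simpa using hB)
    have hcard : hBfin.toFinset.card = N + 1 := by
      have := hBfin.encard_eq_coe_toFinset_card
      rw [hB] at this
      exact_mod_cast this.symm
    let e := hBfin.toFinset.equivFinOfCardEq hcard
    have hmem : ∀ i, (e.symm i : ℝ) ∈ A \ {1, -1} := fun i ↦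
      hBA (hBfin.mem_toFinset.1 (e.symm i).2)
    choose u hu using fun i ↦ (hmem i).1
    have hle := (card_le_rank_vectorSpan_cell hf u
      (fun i j hij ↦ by
        simp only [hu] at hij
        exact e.symm.injective (Subtype.ext hij))
      (fun i hi ↦ by
        have h₁ := (hmem i).2
        rw [← hu i] at h₁
        apply h₁
        have h₂ := Real.sin_sq_add_cos_sq (2 * Real.pi * f (u i))
        rw [hi] at h₂
        have h₃ : Real.cos (2 * Real.pi * f (u i)) ^ 2 = 1 := by linarith
        simpa using h₃)).trans hrank
    have := Nat.cast_le.1 hle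
    omega
  have hA₂ : A.encard ≤ (N + 2 : ℕ) := by
    calc A.encard ≤ ((A \ {1, -1}) ∪ {1, -1}).encard := Set.encard_le_encard (by
          rw [Set.sdiff_union_self]; exact Set.subset_union_left)
      _ ≤ (A \ {1, -1}).encard + ({1, -1} : Set ℝ).encard := Set.encard_union_le _ _
      _ ≤ N + 2 := add_le_add hA₁ (by
          rw [Set.encard_pair (by norm_num)])
      _ = _ := by simp
  set T : Set ℝ := Set.range fun u ↦ Int.fract (f u) with hT
  have hcos : ∀ u, Real.cos (2 * Real.pi * Int.fract (f u)) ∈ A := by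
    refine fun u ↦ ⟨u, ?_⟩
    rw [show 2 * Real.pi * Int.fract (f u) = 2 * Real.pi * f u - ⌊f u⌋ * (2 * Real.pi) by
      rw [← Int.self_sub_floor]; ring, Real.cos_sub_int_mul_two_pi]
  have hpi := Real.pi_pos
  have hT₁ : (T ∩ Set.Iic (1 / 2)).encard ≤ A.encard := by
    refine Set.encard_le_encard_of_injOn (f := fun t ↦ Real.cos (2 * Real.pi * t)) ?_ ?_
    · rintro _ ⟨⟨u, rfl⟩, -⟩
      exact hcos u
    · rintro _ ⟨⟨u, rfl⟩, hu⟩ _ ⟨⟨v, rfl⟩, hv⟩ h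
      simp only [Set.mem_Iic] at hu hv
      have h₁ := Real.injOn_cos (x₁ := 2 * Real.pi * Int.fract (f u))
        (x₂ := 2 * Real.pi * Int.fract (f v))
        ⟨by have := Int.fract_nonneg (f u); positivity, by nlinarith⟩
        ⟨by have := Int.fract_nonneg (f v); positivity, by nlinarith⟩ h
      exact mul_left_cancel₀ (by positivity) h₁
  have hT₂ : (T \ Set.Iic (1 / 2)).encard ≤ A.encard := by
    refine Set.encard_le_encard_of_injOn (f := fun t ↦ Real.cos (2 * Real.pi * t)) ?_ ?_
    · rintro _ ⟨⟨u, rfl⟩, -⟩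
      exact hcos u
    · rintro _ ⟨⟨u, rfl⟩, hu⟩ _ ⟨⟨v, rfl⟩, hv⟩ h
      simp only [Set.mem_Iic, not_le] at hu hv
      have hu₁ := (Int.fract_lt_one (f u)).le
      have hv₁ := (Int.fract_lt_one (f v)).le
      simp only at h
      rw [← Real.cos_two_pi_sub (2 * Real.pi * Int.fract (f u)),
        ← Real.cos_two_pi_sub (2 * Real.pi * Int.fract (f v))] at h
      have h₁ := Real.injOn_cos ⟨by nlinarith, by nlinarith⟩ ⟨by nlinarith, by nlinarith⟩ h
      exact mul_left_cancel₀ (a := 2 * Real.pi) (by positivity) (by linarith)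
  have hT₃ : T.encard ≤ ((N + 2) * 2 : ℕ) := by
    rw [← Set.encard_sdiff_add_encard_inter T (Set.Iic (1 / 2))]
    refine (add_le_add (hT₂.trans hA₂) (hT₁.trans hA₂)).trans_eq ?_
    norm_cast
    ring
  have hfin : T.Finite := Set.finite_of_encard_le_coe hT₃
  have : Fintype T := hfin.fintype
  have hcard : Fintype.card T ≤ (N + 2) * 2 := by
    rw [← Set.toFinset_card]
    rw [Set.encard_eq_coe_toFinset_card] at hT₃
    exact_mod_cast hT₃
  obtain ⟨e⟩ : Nonempty (T ↪ Fin ((N + 2) * 2)) :=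
    Function.Embedding.nonempty_of_card_le (by simpa using hcard)
  refine ⟨Function.extend e (fun t ↦ (t : ℝ)) 0, fun i ↦ ?_, fun u ↦ ?_⟩
  · by_cases hi : ∃ t, e t = i
    · obtain ⟨⟨_, ⟨u, rfl⟩⟩, rfl⟩ := hi
      rw [e.injective.extend_apply]
      exact ⟨Int.fract_nonneg _, (Int.fract_lt_one _).le⟩
    · rw [Function.extend_apply' _ _ _ hi]
      simp
  · exact ⟨e ⟨_, u, rfl⟩, by rw [e.injective.extend_apply]⟩

end Hull

/-! ### The minimal displacement is attained and rational. -/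

section Displacement

variable {V : Type*} {X : SimpleGraph V}

/-- In finite combinatorial dimension the minimal displacement is attained, by a function whose
values have finitely many fractional parts. -/
theorem exists_minimal_displacement [Nonempty V] (hdim : combinatorialDimension X ≠ ⊤)
    {S : Set (X ≃g X)} (h1 : 1 ∈ S) (hS : ∀ s ∈ S, s⁻¹ ∈ S)
    (hne : ∃ r f, IsAdmissible X f ∧ DisplacedAtMost S r f) :
    ∃ l f, 0 ≤ l ∧ IsAdmissible X f ∧ DisplacedAtMost S l f ∧
      (Set.range fun u ↦ Int.fract (f u)).Finite ∧
      ∀ r g, IsAdmissible X g → DisplacedAtMost S r g → l ≤ r := by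
  set A : Set ℝ := {r | ∃ f, IsAdmissible X f ∧ DisplacedAtMost S r f} with hA
  have hA0 : ∀ r ∈ A, 0 ≤ r := by
    rintro r ⟨f, -, hf⟩
    have := hf 1 h1 (Classical.arbitrary V)
    rw [RelIso.one_apply] at this
    linarith
  have hbdd : BddBelow A := ⟨0, hA0⟩
  set l := sInf A with hl
  have hl0 : 0 ≤ l := le_csInf hne hA0
  have hseq : ∀ n : ℕ, ∃ f ∈ injectiveHull X, DisplacedAtMost S (l + 1 / ((n : ℝ) + 1)) f := by
    intro n
    obtain ⟨r, ⟨f, hf, hr⟩, hlt⟩ := exists_lt_of_csInf_lt hne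
      (show sInf A < l + 1 / ((n : ℝ) + 1) by
        have : 0 < 1 / ((n : ℝ) + 1) := by positivity
        linarith)
    exact hf.exists_mem_injectiveHull hS fun s hs u ↦ (hr s hs u).trans (by linarith)
  obtain ⟨M, hM⟩ := exists_fract_eq_of_combinatorialDimension_ne_top hdim
  choose f hf hfr using hseq
  choose t ht i hi using fun n ↦ hM (f n) (hf n)
  have hfloor : ∀ n u, f n u = ⌊f n u⌋ + t n (i n u) := fun n u ↦ by
    rw [← hi, Int.floor_add_fract]
  let U : Ultrafilter ℕ := Filter.hyperfilter ℕ
  have hU : (U : Filter ℕ) ≤ Filter.atTop := by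
    rw [← Nat.cofinite_eq_atTop]
    exact Filter.hyperfilter_le_cofinite
  obtain ⟨a, ha, hta⟩ := (isCompact_univ_pi fun _ : Fin M ↦
    isCompact_Icc (a := (0 : ℝ)) (b := 1)).ultrafilter_le_nhds (U.map t) (by
      rw [Filter.le_principal_iff]
      exact Filter.Eventually.of_forall (f := (U : Filter ℕ)) fun n k _ ↦ ht n k)
  have htend : ∀ k, Filter.Tendsto (fun n ↦ t n k) U (nhds (a k)) := fun k ↦
    (tendsto_pi_nhds.1 (show Filter.Tendsto t U (nhds a) from hta)) k
  have ha01 : ∀ k, 0 ≤ a k ∧ a k ≤ 1 := fun k ↦ ha k trivial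
  -- A constraint on a pair of points depends only on an integer offset and two classes of
  -- fractional parts. `P` and `Q` record which such patterns occur for `f n`, wherever they occur.
  let P : ℕ → Fin M → Fin M → ℤ → Prop := fun n j k z ↦
    ∃ u v, ⌊f n u⌋ + ⌊f n v⌋ - (X.dist u v : ℤ) = z ∧ i n u = j ∧ i n v = k
  let Q : ℕ → Fin M → Fin M → ℤ → Prop := fun n j k z ↦
    ∃ s ∈ S, ∃ u, ⌊f n (s u)⌋ - ⌊f n u⌋ = z ∧ i n u = j ∧ i n (s u) = k
  have hrec : ∀ p : ℕ → Prop, ∀ᶠ n in (U : Filter ℕ), p n → ∀ᶠ m in (U : Filter ℕ), p m := by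
    intro p
    by_cases hp : ∀ᶠ m in (U : Filter ℕ), p m
    · exact Filter.Eventually.of_forall fun n _ ↦ hp
    · exact (Ultrafilter.eventually_not.2 hp).mono fun n hn h ↦ absurd h hn
  have hevP : ∀ᶠ n in (U : Filter ℕ), ∀ j k, ∀ z ∈ Set.Icc (-2 : ℤ) 0, P n j k z →
      ∀ᶠ m in (U : Filter ℕ), P m j k z :=
    Filter.eventually_all.2 fun j ↦ Filter.eventually_all.2 fun k ↦
      (Filter.eventually_all_finite (Set.finite_Icc _ _)).2 fun z _ ↦ hrec _
  have hevQ : ∀ᶠ n in (U : Filter ℕ), ∀ j k, ∀ z ∈ Set.Icc (0 : ℤ) (⌈l⌉ + 2), Q n j k z →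
      ∀ᶠ m in (U : Filter ℕ), Q m j k z :=
    Filter.eventually_all.2 fun j ↦ Filter.eventually_all.2 fun k ↦
      (Filter.eventually_all_finite (Set.finite_Icc _ _)).2 fun z _ ↦ hrec _
  -- Only finitely many patterns matter, so some `n` shows only those that recur for almost all `m`.
  -- Keeping the integer parts and classes of this `f n` and putting in the limits `a`, each
  -- constraint is a limit of valid ones; offsets outside the two ranges are automatic or
  -- impossible.
  obtain ⟨n, hnP, hnQ⟩ := (hevP.and hevQ).exists
  refine ⟨l, fun u ↦ ⌊f n u⌋ + a (i n u), hl0, fun u v ↦ ?_, fun s hs u ↦ ?_, ?_,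
    fun r g hg hr ↦ csInf_le hbdd ⟨g, hg, hr⟩⟩
  · set z : ℤ := ⌊f n u⌋ + ⌊f n v⌋ - (X.dist u v : ℤ) with hz
    have hzr : (z : ℝ) = ⌊f n u⌋ + ⌊f n v⌋ - X.dist u v := by
      rw [hz]
      push_cast
      ring
    suffices h : 0 ≤ (z : ℝ) + a (i n u) + a (i n v) by
      simp only
      linarith
    rcases lt_or_ge 0 z with hz0 | hz0
    · have : (0 : ℝ) < z := by exact_mod_cast hz0
      linarith [(ha01 (i n u)).1, (ha01 (i n v)).1]
    · have hz2 : -2 ≤ z := by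
        have h₁ := (hf n).1 u v
        rw [hfloor n u, hfloor n v] at h₁
        have h₂ : (-2 : ℝ) ≤ z := by
          linarith [(ht n (i n u)).2, (ht n (i n v)).2]
        exact_mod_cast h₂
      have hev := hnP (i n u) (i n v) z ⟨hz2, hz0⟩ ⟨u, v, rfl, rfl, rfl⟩
      refine ge_of_tendsto ((tendsto_const_nhds.add (htend _)).add (htend _)) (hev.mono ?_)
      rintro m ⟨u', v', hz', hu', hv'⟩
      have h₁ := (hf m).1 u' v'
      rw [hfloor m u', hfloor m v', hu', hv'] at h₁
      rw [← hz']
      push_cast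
      linarith
  · set z : ℤ := ⌊f n (s u)⌋ - ⌊f n u⌋ with hz
    have hzr : (z : ℝ) = ⌊f n (s u)⌋ - ⌊f n u⌋ := by
      rw [hz]
      push_cast
      ring
    suffices h : (z : ℝ) + a (i n (s u)) - a (i n u) ≤ l by
      simp only
      linarith
    have hdisp : ∀ m (s : X ≃g X) u, s ∈ S → ((⌊f m (s u)⌋ - ⌊f m u⌋ : ℤ) : ℝ) +
        t m (i m (s u)) - t m (i m u) ≤ l + 1 / ((m : ℝ) + 1) := by
      intro m s u hs
      have h₁ := hfr m s hs u
      rw [hfloor m u, hfloor m (s u)] at h₁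
      push_cast
      linarith
    rcases lt_or_ge z 0 with hz0 | hz0
    · have : (z : ℝ) ≤ -1 := by exact_mod_cast Int.le_sub_one_of_lt hz0
      linarith [(ha01 (i n u)).1, (ha01 (i n (s u))).2]
    · have hz2 : z ≤ ⌈l⌉ + 2 := by
        have h₁ := hdisp n s u hs
        have h₂ : 1 / ((n : ℝ) + 1) ≤ 1 := by
          rw [div_le_one (by positivity)]
          linarith [(Nat.cast_nonneg n : (0 : ℝ) ≤ n)]
        have h₃ : (z : ℝ) ≤ ⌈l⌉ + 2 := by
          linarith [(ht n (i n (s u))).1, (ht n (i n u)).2, Int.le_ceil l]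
        exact_mod_cast h₃
      have hev := hnQ (i n u) (i n (s u)) z ⟨hz0, hz2⟩ ⟨s, hs, u, rfl, rfl, rfl⟩
      have hlim : Filter.Tendsto (fun m : ℕ ↦ l + 1 / ((m : ℝ) + 1)) U (nhds (l + 0)) :=
        tendsto_const_nhds.add (tendsto_one_div_add_atTop_nhds_zero_nat.mono_left hU)
      rw [add_zero] at hlim
      refine le_of_tendsto_of_tendsto ((tendsto_const_nhds.add (htend _)).sub (htend _)) hlim
        (hev.mono ?_)
      rintro m ⟨s', hs', u', hz', hu', hv'⟩
      have h₁ := hdisp m s' u' hs'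
      rw [hu', hv', hz'] at h₁
      exact h₁
  · refine (Set.finite_range fun k ↦ Int.fract (a k)).subset ?_
    rintro _ ⟨u, rfl⟩
    exact ⟨i n u, by simp⟩

/-- A positive number is at least its fractional part, and at least 1 if that part vanishes. -/
theorem exists_pos_le_of_finite_fract {F : Set ℝ} (hF : F.Finite) :
    ∃ μ : ℝ, 0 < μ ∧ ∀ e : ℝ, Int.fract e ∈ F → 0 < e → μ ≤ e := by
  have h : ∃ μ : ℝ, 0 < μ ∧ ∀ c ∈ F, 0 < c → μ ≤ c := by
    induction F, hF using Set.Finite.induction_on with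
    | empty => exact ⟨1, one_pos, by simp⟩
    | @insert b F _ _ ih =>
      obtain ⟨μ, hμ, h⟩ := ih
      by_cases hb : 0 < b
      · refine ⟨min μ b, lt_min hμ hb, ?_⟩
        rintro c (rfl | hc) hc0
        · exact min_le_right _ _
        · exact (min_le_left _ _).trans (h c hc hc0)
      · refine ⟨μ, hμ, ?_⟩
        rintro c (rfl | hc) hc0
        · exact absurd hc0 hb
        · exact h c hc hc0
  obtain ⟨μ, hμ, h⟩ := h
  refine ⟨min μ 1, lt_min hμ one_pos, fun e he he0 ↦ ?_⟩
  rcases (Int.fract_nonneg e).eq_or_lt with h0 | h0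
  · have h₁ := Int.floor_add_fract e
    rw [← h0, add_zero] at h₁
    rw [← h₁] at he0 ⊢
    exact (min_le_right _ _).trans (by exact_mod_cast Int.add_one_le_of_lt (Int.cast_pos.1 he0))
  · have h₁ : (0 : ℝ) ≤ ⌊e⌋ := by exact_mod_cast Int.floor_nonneg.2 he0.le
    have h₂ := Int.floor_add_fract e
    linarith [(min_le_left μ 1).trans (h _ he h0)]

/-- A minimal displacement attained by a function with finitely many fractional parts is
rational. -/
theorem exists_rat_eq_of_minimal_displacement {S : Set (X ≃g X)} {l : ℝ} {f : V → ℝ}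
    (hf : IsAdmissible X f) (hl : DisplacedAtMost S l f)
    (hfin : (Set.range fun u ↦ Int.fract (f u)).Finite)
    (hmin : ∀ r g, IsAdmissible X g → DisplacedAtMost S r g → l ≤ r) : ∃ q : ℚ, l = q := by
  by_contra hirr
  push Not at hirr
  obtain ⟨ξ₀, hξl₀, hξ1₀⟩ := Submodule.exists_dual_map_eq_bot_of_notMem
    (R := ℚ) (x := l) (p := Submodule.span ℚ {(1 : ℝ)}) (by
      intro h
      obtain ⟨q, hq⟩ := Submodule.mem_span_singleton.1 h
      exact hirr q (by rw [← hq, Rat.smul_def, mul_one])) inferInstance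
  -- Adding `ε * ξ (f u)` preserves every equality `f u + f v = d u v` and lowers every displacement
  -- equal to `l` by `ε`. As `ξ` kills integers, it is bounded on the values of `f`.
  obtain ⟨ξ, hξl, hξ1⟩ : ∃ ξ : ℝ →ₗ[ℚ] ℚ, ξ l = -1 ∧ ξ 1 = 0 := by
    refine ⟨(-(ξ₀ l)⁻¹) • ξ₀, by simp [hξl₀], ?_⟩
    have : ξ₀ 1 ∈ (Submodule.span ℚ {(1 : ℝ)}).map ξ₀ :=
      Submodule.mem_map_of_mem (Submodule.mem_span_singleton_self _)
    rw [hξ1₀, Submodule.mem_bot] at this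
    simp [this]
  have hξint : ∀ z : ℤ, ξ (z : ℝ) = 0 := by
    intro z
    have : (z : ℝ) = (z : ℚ) • (1 : ℝ) := by simp [Rat.smul_def]
    rw [this, map_smul, hξ1, smul_zero]
  have hξnat : ∀ z : ℕ, ξ (z : ℝ) = 0 := fun z ↦ by exact_mod_cast hξint z
  obtain ⟨B, hB⟩ : ∃ B : ℝ, ∀ u, |(ξ (f u) : ℝ)| ≤ B := by
    obtain ⟨B, hB⟩ := (hfin.image fun c ↦ |(ξ c : ℝ)|).bddAbove
    refine ⟨B, fun u ↦ hB ⟨Int.fract (f u), ⟨u, rfl⟩, ?_⟩⟩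
    simp only
    rw [← Int.self_sub_floor, map_sub, hξint, sub_zero]
  set T := Set.range fun u ↦ Int.fract (f u) with hT
  obtain ⟨μ₁, hμ₁, h₁⟩ := exists_pos_le_of_finite_fract
    (hfin.image2 (fun c c' ↦ Int.fract (c + c')) hfin)
  obtain ⟨μ₂, hμ₂, h₂⟩ := exists_pos_le_of_finite_fract
    (hfin.image2 (fun c c' ↦ Int.fract (l - c + c')) hfin)
  have hsum : ∀ u v, Int.fract (f u + f v - X.dist u v) ∈
      Set.image2 (fun c c' ↦ Int.fract (c + c')) T T := by
    refine fun u v ↦ ⟨_, ⟨u, rfl⟩, _, ⟨v, rfl⟩, Int.fract_eq_fract.2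
      ⟨(X.dist u v : ℤ) - ⌊f u⌋ - ⌊f v⌋, ?_⟩⟩
    simp only [← Int.self_sub_floor]
    push_cast
    ring
  have hdiff : ∀ u v, Int.fract (l - (f u - f v)) ∈
      Set.image2 (fun c c' ↦ Int.fract (l - c + c')) T T := by
    refine fun u v ↦ ⟨_, ⟨u, rfl⟩, _, ⟨v, rfl⟩, Int.fract_eq_fract.2 ⟨⌊f u⌋ - ⌊f v⌋, ?_⟩⟩
    simp only [← Int.self_sub_floor]
    push_cast
    ring
  by_cases hV : Nonempty V
  swap
  · rw [not_nonempty_iff] at hV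
    linarith [hmin (l - 1) f hf fun s _ u ↦ isEmptyElim u]
  have hB0 : 0 ≤ B := (abs_nonneg _).trans (hB (Classical.arbitrary V))
  -- Strict inequalities have slack at least `min μ₁ μ₂`; this `ε` uses up at most half of it.
  set ε := min μ₁ μ₂ / (4 * (B + 1)) with hε
  have hμ : 0 < min μ₁ μ₂ := lt_min hμ₁ hμ₂
  have hε0 : 0 < ε := by positivity
  have hεB : ε * (2 * B) ≤ min μ₁ μ₂ / 2 := by
    rw [hε, div_mul_eq_mul_div, div_le_div_iff₀ (by positivity) (by positivity)]
    nlinarith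
  have hmin₁ := min_le_left μ₁ μ₂
  have hmin₂ := min_le_right μ₁ μ₂
  have hlt : max (l - ε) (l - min μ₁ μ₂ / 2) < l := max_lt (by linarith) (by linarith)
  refine absurd (hmin (max (l - ε) (l - min μ₁ μ₂ / 2)) (fun u ↦ f u + ε * ξ (f u)) ?_ ?_)
    (not_le.2 hlt)
  · intro u v
    have hu := abs_le.1 (hB u)
    have hv := abs_le.1 (hB v)
    simp only
    rcases (sub_nonneg.2 (hf u v)).eq_or_lt with h0 | h0
    · have h₃ : ξ (f u) + ξ (f v) = 0 := by
        rw [← map_add, ← hξnat (X.dist u v)]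
        congr 1
        linarith
      have h₄ : (ξ (f u) : ℝ) + ξ (f v) = 0 := by exact_mod_cast h₃
      have h₅ : ε * (ξ (f u) : ℝ) + ε * ξ (f v) = 0 := by rw [← mul_add, h₄, mul_zero]
      linarith
    · have h₃ := h₁ _ (hsum u v) h0
      have h₄ : ε * -(2 * B) ≤ ε * ((ξ (f u) : ℝ) + ξ (f v)) :=
        mul_le_mul_of_nonneg_left (by linarith) hε0.le
      linarith
  · intro s hs u
    have hu := abs_le.1 (hB u)
    have hv := abs_le.1 (hB (s u))
    simp only
    have hnn : 0 ≤ l - (f (s u) - f u) := by linarith [hl s hs u]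
    rcases hnn.eq_or_lt with h0 | h0
    · have h₃ : ξ (f (s u)) - ξ (f u) = -1 := by
        rw [← map_sub, ← hξl]
        congr 1
        linarith
      have h₄ : (ξ (f (s u)) : ℝ) - ξ (f u) = -1 := by exact_mod_cast h₃
      have h₅ : ε * (ξ (f (s u)) : ℝ) - ε * ξ (f u) = -ε := by rw [← mul_sub, h₄]; ring
      linarith [le_max_left (l - ε) (l - min μ₁ μ₂ / 2)]
    · have h₃ := h₂ _ (hdiff (s u) u) h0
      have h₄ : ε * ((ξ (f (s u)) : ℝ) - ξ (f u)) ≤ ε * (2 * B) :=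
        mul_le_mul_of_nonneg_left (by linarith) hε0.le
      linarith [le_max_right (l - ε) (l - min μ₁ μ₂ / 2)]

end Displacement

/-! ### Speed of words and the pigeonhole on prefixes. -/

section Words

open scoped Pointwise

variable {V : Type*} {X : SimpleGraph V}

theorem DisplacedAtMost.apply_le_of_mem_pow {S : Set (X ≃g X)} {r : ℝ} {f : V → ℝ}
    (hf : DisplacedAtMost S r f) {n : ℕ} {v : X ≃g X} (hv : v ∈ S ^ n) (u : V) :
    f (v u) ≤ f u + n * r := by
  induction n generalizing v with
  | zero =>
    rw [pow_zero, Set.mem_one] at hv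
    simp [hv]
  | succ n ih =>
    rw [pow_succ'] at hv
    obtain ⟨s, hs, w, hw, rfl⟩ := hv
    have h₁ := hf s hs (w u)
    have h₂ := ih hw
    rw [RelIso.mul_apply]
    push_cast
    linarith

theorem DisplacedAtMost.dist_le_of_mem_pow {S : Set (X ≃g X)} {r : ℝ} {f : V → ℝ}
    (hf : DisplacedAtMost S r f) (hadm : IsAdmissible X f) {n : ℕ} {v : X ≃g X} (hv : v ∈ S ^ n)
    (x : V) : (X.dist x (v x) : ℝ) ≤ 2 * f x + n * r := by
  linarith [hadm x (v x), hf.apply_le_of_mem_pow hv x]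

theorem mem_closure_of_mem_pow {S : Set (X ≃g X)} {n : ℕ} {v : X ≃g X} (hv : v ∈ S ^ n) :
    v ∈ Subgroup.closure S := by
  induction n generalizing v with
  | zero =>
    rw [pow_zero, Set.mem_one] at hv
    exact hv ▸ Subgroup.one_mem _
  | succ n ih =>
    obtain ⟨w, hw, s, hs, rfl⟩ := hv
    exact Subgroup.mul_mem _ (ih hw) (Subgroup.subset_closure hs)

theorem inv_mem_pow {S : Set (X ≃g X)} (hS : ∀ s ∈ S, s⁻¹ ∈ S) {n : ℕ} {v : X ≃g X}
    (hv : v ∈ S ^ n) : v⁻¹ ∈ S ^ n := by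
  have h : S⁻¹ = S := Set.Subset.antisymm
    (fun s hs ↦ by simpa using hS _ (Set.mem_inv.1 hs)) fun s hs ↦ Set.mem_inv.2 (hS s hs)
  rw [← h, inv_pow, Set.inv_mem_inv]
  exact hv

theorem exists_prefixes_of_mem_pow {S : Set (X ≃g X)} {n : ℕ} {v : X ≃g X} (hv : v ∈ S ^ n) :
    ∃ w : ℕ → (X ≃g X), w 0 = 1 ∧ w n = v ∧
      ∀ i j, i ≤ j → j ≤ n → (w i)⁻¹ * w j ∈ S ^ (j - i) := by
  induction n generalizing v with
  | zero =>
    rw [pow_zero, Set.mem_one] at hv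
    exact ⟨fun _ ↦ 1, rfl, hv.symm, fun i j hij hj ↦ by
      obtain rfl : j = 0 := by omega
      simp⟩
  | succ n ih =>
    obtain ⟨v', hv', s, hs, rfl⟩ := hv
    obtain ⟨w, hw0, hwn, hw⟩ := ih hv'
    refine ⟨fun i ↦ if i ≤ n then w i else v' * s, by simpa, by simp, fun i j hij hj ↦ ?_⟩
    by_cases hjn : j ≤ n
    · simpa [hjn, hij.trans hjn] using hw i j hij hjn
    · obtain rfl : j = n + 1 := by omega
      by_cases hin : i ≤ n
      · have h₁ := Set.mul_mem_mul (hw i n hin le_rfl) hs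
        rw [hwn, ← pow_succ, mul_assoc] at h₁
        simpa [hin, Nat.succ_sub hin] using h₁
      · obtain rfl : i = n + 1 := by omega
        simp

/-- If all words displace a base point by at most an affine function of their length, then its
slope bounds the displacement of some admissible function. -/
theorem exists_displacedAtMost_of_forall_pow (hX : X.Connected) {S : Set (X ≃g X)}
    (hS : ∀ s ∈ S, s⁻¹ ∈ S) (x : V) {L K : ℝ}
    (h : ∀ k : ℕ, ∀ v ∈ S ^ k, (X.dist x (v x) : ℝ) ≤ k * L + K) :
    ∃ g, IsAdmissible X g ∧ DisplacedAtMost S L g := by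
  let I := {p : ℕ × (X ≃g X) // p.2 ∈ S ^ p.1}
  -- The infimum over `p` weighs reaching `u` from `p.1.2 x` against `L` per letter; prepending `s`
  -- costs `L`. Admissibility comes from applying `h` to the quotient of two words.
  let φ : V → I → ℝ := fun u p ↦ p.1.1 * L + X.dist (p.1.2 x) u
  have : Nonempty I := ⟨⟨(0, 1), by simp⟩⟩
  have hbdd : ∀ u, BddBelow (Set.range (φ u)) := by
    refine fun u ↦ ⟨-K, ?_⟩
    rintro _ ⟨p, rfl⟩
    have h₁ := h _ _ p.2
    have h₂ : (0 : ℝ) ≤ X.dist x (p.1.2 x) := Nat.cast_nonneg _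
    have h₃ : (0 : ℝ) ≤ X.dist (p.1.2 x) u := Nat.cast_nonneg _
    simp only [φ]
    linarith
  refine ⟨fun u ↦ K / 2 + ⨅ p, φ u p, fun u u' ↦ ?_, fun s hs u ↦ ?_⟩
  · have key : ∀ p p', (X.dist u u' : ℝ) ≤ K + φ u p + φ u' p' := by
      intro p p'
      have h₁ := h (p.1.1 + p'.1.1) (p.1.2⁻¹ * p'.1.2) (by
        rw [pow_add]
        exact Set.mul_mem_mul (inv_mem_pow hS p.2) p'.2)
      have h₂ := dist_triangle_real hX u (p.1.2 x) u'
      have h₃ := dist_triangle_real hX (p.1.2 x) (p'.1.2 x) u'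
      rw [RelIso.mul_apply, SimpleGraph.dist_comm, dist_inv_apply, SimpleGraph.dist_comm] at h₁
      rw [SimpleGraph.dist_comm (u := u) (v := p.1.2 x)] at h₂
      simp only [φ]
      push_cast at h₁
      linarith
    have h₁ : ∀ p, (X.dist u u' : ℝ) - K - φ u p ≤ ⨅ p, φ u' p := fun p ↦
      le_ciInf fun p' ↦ by linarith [key p p']
    have h₂ : (X.dist u u' : ℝ) - K - ⨅ p, φ u' p ≤ ⨅ p, φ u p :=
      le_ciInf fun p ↦ by linarith [h₁ p]
    simp only
    linarith
  · have h₁ : (⨅ p, φ (s u) p) - L ≤ ⨅ p, φ u p := le_ciInf fun p ↦ by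
      have h₂ := ciInf_le (hbdd (s u)) ⟨(p.1.1 + 1, s * p.1.2), by
        rw [pow_succ']
        exact Set.mul_mem_mul hs p.2⟩
      simp only [φ, RelIso.mul_apply, dist_apply_apply] at h₂ ⊢
      push_cast at h₂
      linarith
    simp only
    linarith

/-- The minimal displacement is the asymptotic rate of displacement of the base point by words. -/
theorem exists_lt_dist_of_minimal_displacement (hX : X.Connected) {S : Set (X ≃g X)}
    (hS : ∀ s ∈ S, s⁻¹ ∈ S) (x : V) {l : ℝ} {f : V → ℝ} (hf : IsAdmissible X f)
    (hl : DisplacedAtMost S l f)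
    (hmin : ∀ r g, IsAdmissible X g → DisplacedAtMost S r g → l ≤ r) (n : ℕ) :
    ∃ v ∈ S ^ n, n * l - 1 < (X.dist x (v x) : ℝ) := by
  rcases n.eq_zero_or_pos with rfl | hn
  · exact ⟨1, by simp, by simp⟩
  by_contra! hle
  -- Cutting words into blocks of length `n` would lower the slope to `l - 1 / n`, contradicting
  -- minimality.
  have hblock : ∀ q r : ℕ, ∀ v ∈ S ^ (n * q + r),
      (X.dist x (v x) : ℝ) ≤ q * (n * l - 1) + (2 * f x + r * l) := by
    intro q r
    induction q with
    | zero =>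
      intro v hv
      rw [mul_zero, zero_add] at hv
      simpa using hl.dist_le_of_mem_pow hf hv x
    | succ q ih =>
      intro v hv
      rw [show n * (q + 1) + r = n + (n * q + r) by ring, pow_add] at hv
      obtain ⟨a, ha, b, hb, rfl⟩ := hv
      have h₁ := dist_triangle_real hX x (a x) (a (b x))
      rw [dist_apply_apply] at h₁
      rw [RelIso.mul_apply]
      have h₂ := hle a ha
      have h₃ := ih b hb
      push_cast
      linarith
  have hn' : (0 : ℝ) < n := by exact_mod_cast hn
  obtain ⟨g, hg, hgr⟩ := exists_displacedAtMost_of_forall_pow hX hS x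
    (L := l - 1 / n) (K := 2 * f x + 1) (fun k v hv ↦ by
      have h₁ := hblock (k / n) (k % n) v (by rwa [Nat.div_add_mod])
      have h₂ : (k : ℝ) = n * (k / n : ℕ) + (k % n : ℕ) := by
        exact_mod_cast (Nat.div_add_mod k n).symm
      have h₃ : ((k % n : ℕ) : ℝ) / n ≤ 1 := by
        rw [div_le_one hn']
        exact_mod_cast (Nat.mod_lt k hn).le
      have h₄ : (k : ℝ) * (l - 1 / n) = ((k / n : ℕ) : ℝ) * (n * l - 1) +
          (k % n : ℕ) * l - ((k % n : ℕ) : ℝ) / n := by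
        rw [h₂]
        field_simp
        ring
      linarith)
  have := hmin _ g hg hgr
  have : 0 < 1 / (n : ℝ) := by positivity
  linarith

/-- A word all of whose powers move away from a far point at the rate of its length is
hyperbolic. -/
theorem IsHelly.isHyperbolic_of_busemann (hX : IsHelly X) {γ : X ≃g X} {O x : V} {E R : ℕ} {c : ℝ}
    (hc : 0 < c) (hR : E + 1 ≤ R) (hpow : ∀ k : ℕ, (X.dist x ((γ ^ k) x) : ℝ) ≤ E + k * c)
    (hOc : (X.dist (γ⁻¹ O) x : ℝ) = X.dist O x + c)
    (hT : ∀ q, X.dist x q ≤ R → X.dist O q + X.dist (γ⁻¹ O) x ≤ X.dist (γ⁻¹ O) q + X.dist O x) :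
    IsHyperbolic γ := by
  have key : ∀ k : ℕ, X.dist O x + k * c ≤ (X.dist O ((γ ^ k) x) : ℝ) := by
    intro k
    induction k with
    | zero => simp
    | succ k ih =>
      -- Seen from `O`, the point `(γ ^ k) x` lies beyond `x` up to an error `E`, so the comparison
      -- on the ball about `x` extends to it.
      have h₁ : X.dist O x + X.dist x ((γ ^ k) x) ≤ X.dist O ((γ ^ k) x) + E := by
        have : (X.dist O x + X.dist x ((γ ^ k) x) : ℝ) ≤ X.dist O ((γ ^ k) x) + E := by
          linarith [hpow k]
        exact_mod_cast this
      have h₂ := hX.busemann_le hR h₁ hT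
      rw [dist_inv_apply γ O ((γ ^ k) x), ← RelIso.mul_apply, ← pow_succ'] at h₂
      have h₃ : (X.dist O ((γ ^ k) x) + X.dist (γ⁻¹ O) x : ℝ) ≤
          X.dist O ((γ ^ (k + 1)) x) + X.dist O x := by exact_mod_cast h₂
      push_cast
      linarith
  refine isHyperbolic_of_forall_le_dist hX.1 γ x hc fun k ↦ ?_
  linarith [key k, dist_triangle_real hX.1 O x ((γ ^ k) x)]

/-- A group generated by a symmetric set of automorphisms that displace a vertex by a bounded
amount has bounded orbits or contains a hyperbolic automorphism. -/
theorem IsHelly.bounded_or_exists_isHyperbolic (hX : IsHelly X) (hfin : IsLocallyFinite X)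
    (hdim : combinatorialDimension X ≠ ⊤) {S : Set (X ≃g X)} (h1 : 1 ∈ S)
    (hS : ∀ s ∈ S, s⁻¹ ∈ S) (x : V) (D : ℕ) (hD : ∀ s ∈ S, X.dist x (s x) ≤ D) :
    (∃ M : ℕ, ∀ γ ∈ Subgroup.closure S, X.dist x (γ x) ≤ M) ∨
      ∃ γ ∈ Subgroup.closure S, IsHyperbolic γ := by
  have : Nonempty V := ⟨x⟩
  obtain ⟨l, f, hl0, hf, hl, hfrac, hmin⟩ := exists_minimal_displacement hdim h1 hS
    ⟨D, fun u ↦ X.dist x u, fun u v ↦ by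
      have := dist_triangle_real hX.1 u x v
      rwa [SimpleGraph.dist_comm (u := u) (v := x)] at this, fun s hs u ↦ by
      have h₁ := dist_triangle_real hX.1 x (s x) (s u)
      rw [dist_apply_apply] at h₁
      have h₂ : (X.dist x (s x) : ℝ) ≤ D := by exact_mod_cast hD s hs
      linarith⟩
  have ha0 := hf.nonneg x
  rcases hl0.eq_or_lt with rfl | hlpos
  · refine Or.inl ⟨⌈2 * f x⌉₊, fun γ hγ ↦ ?_⟩
    have hle : ∀ γ ∈ Subgroup.closure S, ∀ u, f (γ u) ≤ f u := by
      intro γ hγ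
      induction hγ using Subgroup.closure_induction'' with
      | one => simp
      | mem s hs => exact fun u ↦ by simpa using hl s hs u
      | inv_mem s hs => exact fun u ↦ by simpa using hl _ (hS s hs) u
      | mul a b _ _ ha hb => exact fun u ↦ (ha (b u)).trans (hb u)
    have h₁ : (X.dist x (γ x) : ℝ) ≤ ⌈2 * f x⌉₊ := by
      linarith [hf x (γ x), hle γ hγ x, Nat.le_ceil (2 * f x)]
    exact_mod_cast h₁
  right
  obtain ⟨q, hq⟩ := exists_rat_eq_of_minimal_displacement hf hl hfrac hmin
  set E := ⌈2 * f x⌉₊ with hE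
  have hEle : 2 * f x ≤ E := Nat.le_ceil _
  set R := E + 1 with hR
  set Z : ℤ := q.den * (E + 1) with hZ
  have hball : Finite {y // X.dist x y ≤ R} := hfin.finite_setOf_dist_le hX.1 x R
  let T := ({y // X.dist x y ≤ R} → Set.Icc (-R : ℤ) R) × Set.Icc (-Z) Z
  obtain ⟨v, hv, hvd⟩ :=
    exists_lt_dist_of_minimal_displacement hX.1 hS x hf hl hmin (Nat.card T)
  obtain ⟨w, hw0, hwn, hw⟩ := exists_prefixes_of_mem_pow hv
  set n := Nat.card T with hn
  have hwi : ∀ i ≤ n, w i ∈ S ^ i := fun i hi ↦ by simpa [hw0] using hw 0 i (Nat.zero_le i) hi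
  have hupper : ∀ i ≤ n, (X.dist x (w i x) : ℝ) ≤ E + i * l := fun i hi ↦ by
    linarith [hl.dist_le_of_mem_pow hf (hwi i hi) x]
  have hlower : ∀ i ≤ n, i * l - (E + 1) ≤ (X.dist x (w i x) : ℝ) := fun i hi ↦ by
    have h₁ := hl.dist_le_of_mem_pow hf (hw i n hi le_rfl) x
    rw [RelIso.mul_apply, SimpleGraph.dist_comm, dist_inv_apply, SimpleGraph.dist_comm,
      Nat.cast_sub hi, hwn] at h₁
    linarith [dist_triangle_real hX.1 x (w i x) (v x)]
  have hden : (0 : ℝ) < q.den := by exact_mod_cast q.den_pos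
  have hlq : (q.den : ℝ) * l = q.num := by
    rw [hq]
    exact_mod_cast Rat.den_mul_eq_num q
  -- The type of a prefix: the distance function of `(w i)⁻¹ x` near `x`, normalised at `x`, and the
  -- deviation of the displacement from `i * l`, an integer after multiplication by `q.den`. The `n
  -- + 1` prefixes share `n` types.
  let F : Fin (n + 1) → T := fun i ↦
    (fun y ↦ ⟨(X.dist ((w i)⁻¹ x) y : ℤ) - X.dist ((w i)⁻¹ x) x, by
      have h₁ := hX.1.dist_triangle (u := (w i)⁻¹ x) (v := x) (w := y)
      have h₂ := hX.1.dist_triangle (u := (w i)⁻¹ x) (v := y) (w := x)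
      rw [SimpleGraph.dist_comm (u := (y : V)) (v := x)] at h₂
      have h₃ := y.2
      constructor <;> omega⟩,
    ⟨q.den * X.dist x (w i x) - i * q.num, by
      have hi : (i : ℕ) ≤ n := Nat.lt_succ_iff.1 i.2
      have h₁ := mul_le_mul_of_nonneg_left (hupper i hi) hden.le
      have h₂ := mul_le_mul_of_nonneg_left (hlower i hi) hden.le
      have h₃ : (q.den : ℝ) * (i * l) = i * q.num := by rw [← hlq]; ring
      rw [mul_add, h₃] at h₁
      rw [mul_sub, h₃] at h₂
      have h₄ : (q.den * (X.dist x (w i x) : ℝ) - i * q.num) ≤ q.den * (E + 1) := by linarith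
      have h₅ : -(q.den * (E + 1) : ℝ) ≤ q.den * (X.dist x (w i x) : ℝ) - i * q.num := by linarith
      constructor
      · rw [hZ]; exact_mod_cast h₅
      · rw [hZ]; exact_mod_cast h₄⟩)
  obtain ⟨i, j, hij, hF⟩ : ∃ i j, i < j ∧ F i = F j := by
    have hni : ¬ Function.Injective F := fun hinj ↦ by
      have := Nat.card_le_card_of_injective F hinj
      simp [← hn] at this
    obtain ⟨i, j, h, hne⟩ := Function.not_injective_iff.1 hni
    rcases lt_or_gt_of_ne hne with hlt | hlt
    · exact ⟨i, j, hlt, h⟩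
    · exact ⟨j, i, hlt, h.symm⟩
  have hjn : (j : ℕ) ≤ n := Nat.lt_succ_iff.1 j.2
  have hij' : (i : ℕ) < j := hij
  have hγ := hw i j hij'.le hjn
  have hγO : ((w i)⁻¹ * w j)⁻¹ ((w i)⁻¹ x) = (w j)⁻¹ x := by
    rw [← RelIso.mul_apply]
    congr 1
    group
  have hcast : (((j : ℕ) - (i : ℕ) : ℕ) : ℝ) = (j : ℕ) - (i : ℕ) := Nat.cast_sub hij'.le
  refine ⟨(w i)⁻¹ * w j, mem_closure_of_mem_pow hγ,
    hX.isHyperbolic_of_busemann (O := (w i)⁻¹ x) (x := x) (E := E) (R := R)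
      (c := ((j - i : ℕ) : ℝ) * l) ?_ le_rfl (fun k ↦ ?_) ?_ fun y hy ↦ ?_⟩
  · have : (0 : ℝ) < ((j - i : ℕ) : ℝ) := by exact_mod_cast Nat.sub_pos_of_lt hij'
    positivity
  · have h₁ := Set.pow_mem_pow (n := k) hγ
    rw [← pow_mul] at h₁
    have h₂ := hl.dist_le_of_mem_pow hf h₁ x
    push_cast at h₂
    linarith
  · rw [hγO, dist_inv_apply, dist_inv_apply, hcast]
    have h₁ := congrArg (fun p ↦ (p.2 : ℤ)) hF
    simp only [F] at h₁
    have h₂ : (q.den * X.dist x (w i x) - (i : ℕ) * q.num : ℝ) =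
        q.den * X.dist x (w j x) - (j : ℕ) * q.num := by exact_mod_cast h₁
    rw [← hlq] at h₂
    apply mul_left_cancel₀ hden.ne'
    linarith
  · rw [hγO]
    have h₁ := congrArg (fun p ↦ (p.1 ⟨y, hy⟩ : ℤ)) hF
    simp only [F] at h₁
    omega

end Words

/-! ### The alternative for groups, and exclusivity. -/

section Alternative

variable {V : Type*} {X : SimpleGraph V}

theorem IsHelly.isElliptic_or_exists_isHyperbolic (hX : IsHelly X) (hfin : IsLocallyFinite X)
    (hdim : combinatorialDimension X ≠ ⊤) {S : Set (X ≃g X)} (h1 : 1 ∈ S)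
    (hS : ∀ s ∈ S, s⁻¹ ∈ S) (x : V) (D : ℕ) (hD : ∀ s ∈ S, X.dist x (s x) ≤ D) :
    IsElliptic (Subgroup.closure S) ∨ ∃ γ ∈ Subgroup.closure S, IsHyperbolic γ :=
  (hX.bounded_or_exists_isHyperbolic hfin hdim h1 hS x D hD).imp_left fun ⟨M, hM⟩ ↦
    hX.isElliptic_of_bounded _ x M hM

theorem IsElliptic.exists_dist_le {K : Subgroup (X ≃g X)} (hK : IsElliptic K) (hX : X.Connected)
    (x : V) : ∃ D : ℕ, ∀ g ∈ K, X.dist x (g x) ≤ D := by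
  obtain ⟨C, ⟨y, hy⟩, hC, hinv⟩ := hK
  refine ⟨2 * X.dist x y + 1, fun g hg ↦ ?_⟩
  have hgy : g y ∈ C := hinv g hg ▸ Set.mem_image_of_mem g hy
  have h₁ : X.dist y (g y) ≤ 1 := by
    by_cases h : y = g y
    · rw [← h]
      simp
    · exact (SimpleGraph.dist_eq_one_iff_adj.2 (hC hy hgy h)).le
  have h₂ := hX.dist_triangle (u := x) (v := y) (w := g x)
  have h₃ := hX.dist_triangle (u := y) (v := g y) (w := g x)
  rw [dist_apply_apply, SimpleGraph.dist_comm (u := y) (v := x)] at h₃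
  omega

theorem not_isHyperbolic_of_isElliptic (hX : X.Connected) {K : Subgroup (X ≃g X)}
    (hK : IsElliptic K) {g : X ≃g X} (hg : g ∈ K) : ¬ IsHyperbolic g := by
  obtain ⟨C, hne, hC, hinv⟩ := hK
  exact not_isHyperbolic_of_image_clique hX hne hC (hinv g hg)

theorem IsHyperbolic.not_isOfFinOrder {g : X ≃g X} (hX : X.Connected) (hg : IsHyperbolic g) :
    ¬ IsOfFinOrder g := by
  intro h
  obtain ⟨N, hN, hgN⟩ := isOfFinOrder_iff_pow_eq_one.1 h
  have ⟨y⟩ := hX.nonempty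
  obtain ⟨n, hn⟩ := hg.not_bounded hX y 0 N hN
  rw [pow_mul, hgN, one_pow] at hn
  simp at hn

end Alternative

end HellyGraph

theorem mainTheorem1 {V : Type*} (X : SimpleGraph V)
    (hHelly : HellyGraph.IsHelly X)
    (hfin : HellyGraph.IsLocallyFinite X)
    (hdim : HellyGraph.combinatorialDimension X ≠ ⊤) :
    (∀ (G : Type*) [Group G] [Group.FG G] (φ : G →* (X ≃g X)),
      Xor (∃ C : Set V, C.Nonempty ∧ X.IsClique C ∧ ∀ g : G, φ g '' C = C)
          (∃ g : G, HellyGraph.IsHyperbolic (φ g)) ∧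
        ∀ g : G, HellyGraph.IsHyperbolic (φ g) → ¬ IsOfFinOrder g) ∧
    (∀ G H : Subgroup (X ≃g X), HellyGraph.IsElliptic G → HellyGraph.IsElliptic H →
      Xor (HellyGraph.IsElliptic (G ⊔ H))
        (∃ g ∈ G ⊔ H, HellyGraph.IsHyperbolic g)) := by
  have hconn := hHelly.1
  have ⟨x⟩ := hconn.nonempty
  refine ⟨fun G _ _ φ ↦ ⟨?_, fun g hg hfo ↦
    hg.not_isOfFinOrder hconn (φ.isOfFinOrder hfo)⟩, fun G H hG hH ↦ ?_⟩
  · rw [xor_iff_or_and_not_and]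
    refine ⟨?_, fun ⟨⟨C, hne, hC, hinv⟩, g, hg⟩ ↦
      HellyGraph.not_isHyperbolic_of_image_clique hconn hne hC (hinv g) hg⟩
    obtain ⟨A, hA⟩ := Group.fg_def.1 ‹Group.FG G›
    set S : Set (X ≃g X) := φ '' (insert 1 (A ∪ (A : Set G)⁻¹)) with hS
    have hSfin : S.Finite :=
      ((A.finite_toSet.union A.finite_toSet.inv).insert 1).image φ
    obtain ⟨D, hD⟩ := (hSfin.image fun s ↦ X.dist x (s x)).bddAbove
    have hclosure : Subgroup.closure S = φ.range := by
      rw [hS, ← MonoidHom.map_closure, MonoidHom.range_eq_map]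
      congr 1
      exact top_le_iff.1 (hA ▸ Subgroup.closure_mono fun a ha ↦ Or.inr (Or.inl ha))
    have h := hHelly.isElliptic_or_exists_isHyperbolic hfin hdim (S := S)
      ⟨1, Or.inl rfl, map_one φ⟩ (by
        rintro _ ⟨g, hg, rfl⟩
        refine ⟨g⁻¹, ?_, map_inv φ g⟩
        rcases hg with rfl | hg | hg
        · exact Or.inl inv_one
        · exact Or.inr (Or.inr (by simpa using hg))
        · exact Or.inr (Or.inl hg)) x D fun s hs ↦ hD ⟨s, hs, rfl⟩
    rw [hclosure] at h
    refine h.imp ?_ ?_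
    · rintro ⟨C, hne, hC, hinv⟩
      exact ⟨C, hne, hC, fun g ↦ hinv _ ⟨g, rfl⟩⟩
    · rintro ⟨_, ⟨g, rfl⟩, hg⟩
      exact ⟨g, hg⟩
  · rw [xor_iff_or_and_not_and]
    refine ⟨?_, fun ⟨h, g, hg, hyp⟩ ↦
      HellyGraph.not_isHyperbolic_of_isElliptic hconn h hg hyp⟩
    obtain ⟨D₁, hD₁⟩ := hG.exists_dist_le hconn x
    obtain ⟨D₂, hD₂⟩ := hH.exists_dist_le hconn x
    -- The union of `G` and `H` may be infinite, but it moves `x` a bounded amount, which is all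
    -- that is needed.
    rw [Subgroup.sup_eq_closure]
    refine hHelly.isElliptic_or_exists_isHyperbolic hfin hdim (Or.inl G.one_mem) ?_ x (max D₁ D₂) ?_
    · rintro s (hs | hs)
      · exact Or.inl (G.inv_mem hs)
      · exact Or.inr (H.inv_mem hs)
    · rintro s (hs | hs)
      · exact (hD₁ s hs).trans (le_max_left _ _)
      · exact (hD₂ s hs).trans (le_max_right _ _)
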